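/- Let $\alpha\ge 0$, and let $(a_k)_{k\ge1}$ and $(b_k)_{k\ge1}$ be two independent centered stationary Gaussian processes with $\mathbb E[a_ka_l]=\mathbb E[b_kb_l]=\cos((k-l)\alpha)$ for all $k,l\ge1$. For $n\ge1$ set $$f_n(t)=\frac1{\sqrt n}\sum_{k=1}^n\bigl(a_k\cos(kt)+b_k\sin(kt)\bigr),\qquad t\in\mathbb R,$$ and, for a function $f$, let $\mathcal N(f,[0,2\pi])$ be the number of distinct zeros of $f$ in $[0,2\pi]$. (i) If $\alpha=0$, then almost surely, for all $n\ge1$, $\mathcal N(f_n,[0,2\pi])=2n$. (ii) If $\alpha\in\pi\mathbb Q$, then $\mathcal N(f_n,[0,2\pi])$ has a finite expectation for every $n\ge1$, and $$\lim_{n\to+\infty}\left|\frac{\mathbb E[\mathcal N(f_n,[0,2\pi])]}{n}-2\right|\mathbf 1_{n\alpha\in\pi\mathbb Z}=0 .$$ (iii) Suppose $\alpha=2\pi p/q$ with positive coprime integers $p,q$, and for $n\ge 1$ with $q\mid n$ set $$\widetilde f_n(t)=\sum_{k=1}^q a_k\cos\Bigl(kt+\frac{(n-q)t}2\Bigr)+b_k\sin\Bigl(kt+\frac{(n-q)t}2\Bigr).$$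 Then, almost surely, for every such $n$ and every $t$ with $\sin(qt/2)\ne0$, $$f_n(t)=\frac1{\sqrt n}\,\widetilde f_n(t)\,\frac{\sin(nt/2)}{\sin(qt/2)},$$ and $$\liminf_{\substack{n\to+\infty\\ q\mid n}}\frac1n\,\mathbb E\bigl[\mathcal N(\widetilde f_n,[0,2\pi])\bigr]\ge1 .$$ -/

import Mathlib

open MeasureTheory ProbabilityTheory Filter Topology
open scoped ENNReal

/-- `(X_k)_{k ≥ 1}` is a centered stationary Gaussian process with correlation function `ρ`, that is
`E[X_k] = 0` and `E[X_k X_{k+j}] = ρ j` for all `k ≥ 1` and `j ≥ 0`. The value `X 0` plays no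
role. -/
structure IsStationaryGaussian {Ω : Type*} [MeasurableSpace Ω] (ρ : ℕ → ℝ) (X : ℕ → Ω → ℝ)
    (P : Measure Ω) : Prop where
  gaussian : IsGaussianProcess (fun k : ℕ+ => X k) P
  mean_zero : ∀ k : ℕ, 1 ≤ k → ∫ ω, X k ω ∂P = 0
  correlation : ∀ k j : ℕ, 1 ≤ k → ∫ ω, X k ω * X (k + j) ω ∂P = ρ j

/-- `(a_k)_{k ≥ 1}` and `(b_k)_{k ≥ 1}` are independent centered stationary Gaussian processes with
the same correlation function `k ↦ cos (k α)`. -/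
structure IsCosineGaussianPair {Ω : Type*} [MeasurableSpace Ω] (α : ℝ) (a b : ℕ → Ω → ℝ)
    (P : Measure Ω) : Prop where
  left : IsStationaryGaussian (fun k : ℕ => Real.cos (k * α)) a P
  right : IsStationaryGaussian (fun k : ℕ => Real.cos (k * α)) b P
  indep : IndepFun (fun ω (k : ℕ+) => a k ω) (fun ω (k : ℕ+) => b k ω) P

/-- `f_n(t) = n^{-1/2} ∑_{k=1}^n (a_k cos (k t) + b_k sin (k t))`, for the realization `ω`. -/
noncomputable def randTrigPoly {Ω : Type*} (a b : ℕ → Ω → ℝ) (n : ℕ) (ω : Ω) (t : ℝ) : ℝ :=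
  1 / Real.sqrt n *
    ∑ k ∈ Finset.Icc 1 n, (a k ω * Real.cos (k * t) + b k ω * Real.sin (k * t))

/-- `f̃_n(t) = ∑_{k=1}^q (a_k cos (k t + (n - q) t / 2) + b_k sin (k t + (n - q) t / 2))`. -/
noncomputable def randTrigFactor {Ω : Type*} (a b : ℕ → Ω → ℝ) (q n : ℕ) (ω : Ω) (t : ℝ) : ℝ :=
  ∑ k ∈ Finset.Icc 1 q,
    (a k ω * Real.cos (k * t + ((n : ℝ) - q) * t / 2) +
      b k ω * Real.sin (k * t + ((n : ℝ) - q) * t / 2))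

/-- The number (possibly infinite) of distinct real zeros of `f` in `[0, 2π]`. -/
noncomputable def zeroCount (f : ℝ → ℝ) : ℕ∞ :=
  {t : ℝ | t ∈ Set.Icc 0 (2 * Real.pi) ∧ f t = 0}.encard

/-- The expected number of zeros in `[0, 2π]` of the random function `F`. -/
noncomputable def expectedZeros {Ω : Type*} [MeasurableSpace Ω] (P : Measure Ω)
    (F : Ω → ℝ → ℝ) : ℝ≥0∞ :=
  ∫⁻ ω, (zeroCount (F ω) : ℝ≥0∞) ∂P

/-! The correlation `cos (k α)` has rank two, so almost surely `a_k` and `b_k` are of the form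
`A cos (k α) + B sin (k α)`. The coefficients `c_k = a_k - i b_k` then satisfy a linear recurrence
of order two, which also defines `c_0`, and `(cos t - cos α) f_n(t)` telescopes to boundary terms.
When `n α ∈ π ℤ` these factor as `sin (n (t + α) / 2)` times the imaginary part of
`(c_1 - c_0 e^{it}) e^{i n (t + α) / 2}`. The first factor has `n` explicit zeros. The second is a
sum of two sinusoids of frequencies `n / 2` and `n / 2 + 1`: it changes sign with the one of larger
amplitude, or splits into a product if the amplitudes agree, so it has about `n` zeros. The zeros of
the first factor are rational multiples of `π`, where almost surely the second does not vanish,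
except possibly at zeros of `cos t - cos α`. Hence `f_n` has at least `2n - 5` zeros; it has at most
`2n + 1` because `e^{int} f_n(t)` is a polynomial of degree at most `2n` in `e^{it}`. For `α = 0`
the recurrence has order one and the same count is exact. For `f̃_n` the zeros of the second factor
suffice. -/

section Zeros

theorem natCast_le_encard_of_injOn {β : Type*} {s : Set β} {f : ℕ → β} {k : ℕ}
    (hf : Set.MapsTo f (Set.Iio k) s) (hinj : Set.InjOn f (Set.Iio k)) : (k : ℕ∞) ≤ s.encard := by
  have hk : (Set.Iio k).encard = k := by
    rw [← Finset.coe_Iio, Set.encard_coe_eq_coe_finsetCard, Nat.card_Iio]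
  exact hk ▸ Set.encard_le_encard_of_injOn hf hinj

theorem exists_mem_Ioo_eq_zero_of_mul_neg {g : ℝ → ℝ} {u v : ℝ} (huv : u ≤ v)
    (hg : ContinuousOn g (Set.Icc u v)) (h : g u * g v < 0) : ∃ t ∈ Set.Ioo u v, g t = 0 := by
  rcases mul_neg_iff.1 h with ⟨hu, hv⟩ | ⟨hu, hv⟩
  · exact intermediate_value_Ioo' huv hg ⟨hv, hu⟩
  · exact intermediate_value_Ioo huv hg ⟨hu, hv⟩

theorem le_encard_zeros_of_alternating {I : Set ℝ} [I.OrdConnected] {g : ℝ → ℝ} {T : ℕ → ℝ}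
    {M : ℕ} (hg : ContinuousOn g I) (hT : StrictMono T) (hI : ∀ i < M, T i ∈ I)
    (hsign : ∀ i, i + 1 < M → g (T i) * g (T (i + 1)) < 0) :
    (M : ℕ∞) ≤ {t ∈ I | g t = 0}.encard + 1 := by
  have hsub : ∀ i, i + 1 < M → Set.Icc (T i) (T (i + 1)) ⊆ I := fun i hi =>
    Set.Icc_subset I (hI i (by omega)) (hI (i + 1) hi)
  have hzero : ∀ i, i + 1 < M → ∃ t ∈ Set.Ioo (T i) (T (i + 1)), g t = 0 := fun i hi =>
    exists_mem_Ioo_eq_zero_of_mul_neg (hT i.lt_succ_self).le (hg.mono (hsub i hi)) (hsign i hi)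
  choose! z hz hz0 using hzero
  have hmono : StrictMonoOn z (Set.Iio (M - 1)) := fun i hi j hj hij =>
    calc z i < T (i + 1) := (hz i (Nat.add_lt_of_lt_sub hi)).2
      _ ≤ T j := hT.monotone hij
      _ < z j := (hz j (Nat.add_lt_of_lt_sub hj)).1
  have hcount : ((M - 1 : ℕ) : ℕ∞) ≤ {t ∈ I | g t = 0}.encard :=
    natCast_le_encard_of_injOn (fun i hi => by
      have hi' : i + 1 < M := Nat.add_lt_of_lt_sub hi
      exact ⟨hsub i hi' (Set.Ioo_subset_Icc_self (hz i hi')), hz0 i hi'⟩) hmono.injOn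
  calc (M : ℕ∞) ≤ ((M - 1 : ℕ) : ℕ∞) + 1 := by exact_mod_cast (by omega : M ≤ M - 1 + 1)
    _ ≤ _ := add_le_add_left hcount 1

theorem encard_zeros_add_encard_zeros_le_of_mul_eq {I : Set ℝ} {f p g h : ℝ → ℝ}
    (hfact : ∀ t ∈ I, p t * f t = g t * h t) :
    {t ∈ I | g t = 0}.encard + {t ∈ I | h t = 0}.encard ≤
      {t ∈ I | f t = 0}.encard + {t ∈ I | p t = 0}.encard +
        {t ∈ I | g t = 0 ∧ h t = 0}.encard := by
  have hunion : {t ∈ I | g t = 0} ∪ {t ∈ I | h t = 0} ⊆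
      {t ∈ I | f t = 0} ∪ {t ∈ I | p t = 0} := by
    rintro t (⟨ht, h0⟩ | ⟨ht, h0⟩)
    all_goals
      have hpf := hfact t ht
      simp only [h0, zero_mul, mul_zero, mul_eq_zero] at hpf
      rcases hpf with hp | hf
      exacts [Or.inr ⟨ht, hp⟩, Or.inl ⟨ht, hf⟩]
  have hinter : {t ∈ I | g t = 0} ∩ {t ∈ I | h t = 0} = {t ∈ I | g t = 0 ∧ h t = 0} :=
    (Set.sep_and ..).symm
  rw [← Set.encard_union_add_encard_inter, hinter]
  gcongr
  exact (Set.encard_le_encard hunion).trans (Set.encard_union_le _ _)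

theorem encard_zeros_cos_sub_le (γ : ℝ) :
    {t ∈ Set.Icc 0 (2 * Real.pi) | Real.cos t - γ = 0}.encard ≤ 2 := by
  have hsub : {t ∈ Set.Icc 0 (2 * Real.pi) | Real.cos t - γ = 0} ⊆
      {Real.arccos γ, 2 * Real.pi - Real.arccos γ} := by
    rintro t ⟨⟨h0, h2⟩, ht⟩
    rw [← sub_eq_zero.1 ht]
    rcases le_total t Real.pi with hle | hle
    · exact Or.inl (Real.arccos_cos h0 hle).symm
    · right
      rw [Set.mem_singleton_iff, ← Real.cos_two_pi_sub,
        Real.arccos_cos (by linarith) (by linarith)]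
      ring
  calc _ ≤ ({Real.arccos γ, 2 * Real.pi - Real.arccos γ} : Set ℝ).encard :=
        Set.encard_le_encard hsub
    _ ≤ ({2 * Real.pi - Real.arccos γ} : Set ℝ).encard + 1 := Set.encard_insert_le _ _
    _ = 2 := by rw [Set.encard_singleton, one_add_one_eq_two]

/-- The `i`-th nonnegative zero of `t ↦ sin (M / 2 * t + φ)`, counted from `i = 0`. -/
noncomputable def sinZero (M : ℕ) (φ : ℝ) (i : ℕ) : ℝ :=
  2 * ((⌈φ / Real.pi⌉ + i) * Real.pi - φ) / M

theorem half_mul_sinZero_add {M : ℕ} (hM : 0 < M) (φ : ℝ) (i : ℕ) :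
    M / 2 * sinZero M φ i + φ = ((⌈φ / Real.pi⌉ + i : ℤ) : ℝ) * Real.pi := by
  rw [sinZero]
  push_cast
  field_simp
  ring

theorem strictMono_sinZero {M : ℕ} (hM : 0 < M) (φ : ℝ) : StrictMono (sinZero M φ) := by
  intro i j hij
  unfold sinZero
  have := Real.pi_pos
  gcongr

theorem sinZero_mem_Ico {M i : ℕ} (φ : ℝ) (hi : i < M) :
    sinZero M φ i ∈ Set.Ico 0 (2 * Real.pi) := by
  have hM : (0 : ℝ) < M := by exact_mod_cast i.zero_le.trans_lt hi
  have hi' : (i : ℝ) + 1 ≤ M := by exact_mod_cast hi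
  have hceil : φ ≤ ⌈φ / Real.pi⌉ * Real.pi := (div_le_iff₀ Real.pi_pos).1 (Int.le_ceil _)
  have hceil' : (⌈φ / Real.pi⌉ - 1) * Real.pi < φ :=
    (lt_div_iff₀ Real.pi_pos).1 (by linarith [Int.ceil_lt_add_one (φ / Real.pi)])
  have hiπ : (i + 1) * Real.pi ≤ M * Real.pi := by gcongr
  have hiπ' : 0 ≤ i * Real.pi := by positivity
  constructor
  · exact div_nonneg (by linarith) hM.le
  · rw [sinZero, div_lt_iff₀ hM]
    linarith

theorem le_encard_zeros_sin (M : ℕ) (φ : ℝ) :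
    (M : ℕ∞) ≤ {t ∈ Set.Ico 0 (2 * Real.pi) | Real.sin (M / 2 * t + φ) = 0}.encard := by
  rcases M.eq_zero_or_pos with rfl | hM
  · simp
  refine natCast_le_encard_of_injOn (fun i hi => ⟨sinZero_mem_Ico φ hi, ?_⟩)
    (strictMono_sinZero hM φ).injective.injOn
  rw [half_mul_sinZero_add hM, Real.sin_int_mul_pi]

theorem le_encard_zeros_cos (M : ℕ) (φ : ℝ) :
    (M : ℕ∞) ≤ {t ∈ Set.Ico 0 (2 * Real.pi) | Real.cos (M / 2 * t + φ) = 0}.encard := by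
  simpa only [← add_assoc, Real.sin_add_pi_div_two] using le_encard_zeros_sin M (φ + Real.pi / 2)

theorem le_encard_zeros_mul_cos_add {M : ℕ} {R φ : ℝ} {r : ℝ → ℝ} (hr : Continuous r)
    (hrR : ∀ t, |r t| < R) :
    (M : ℕ∞) ≤
      {t ∈ Set.Icc 0 (2 * Real.pi) | R * Real.cos (M / 2 * t + φ) + r t = 0}.encard + 1 := by
  rcases M.eq_zero_or_pos with rfl | hM
  · simp
  refine le_encard_zeros_of_alternating (by fun_prop) (strictMono_sinZero hM φ)
    (fun i hi => Set.Ico_subset_Icc_self (sinZero_mem_Ico φ hi)) fun i _ => ?_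
  obtain ⟨hr0, hr0'⟩ := abs_lt.1 (hrR (sinZero M φ i))
  obtain ⟨hr1, hr1'⟩ := abs_lt.1 (hrR (sinZero M φ (i + 1)))
  have hstep : ((⌈φ / Real.pi⌉ + (i + 1 : ℕ) : ℤ) : ℝ) * Real.pi =
      (⌈φ / Real.pi⌉ + i : ℤ) * Real.pi + Real.pi := by
    push_cast
    ring
  rw [half_mul_sinZero_add hM, half_mul_sinZero_add hM, hstep, Real.cos_add_pi]
  rcases eq_or_eq_neg_of_abs_eq (Real.abs_cos_int_mul_pi (⌈φ / Real.pi⌉ + i)) with hcos | hcos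
  · rw [hcos]
    exact mul_neg_of_pos_of_neg (by linarith) (by linarith)
  · rw [hcos]
    exact mul_neg_of_neg_of_pos (by linarith) (by linarith)

theorem le_encard_zeros_cos_add_cos (n : ℕ) {A B : ℝ} (hA : 0 ≤ A) (hB : 0 ≤ B) (φ ψ : ℝ) :
    (n : ℕ∞) ≤ {t ∈ Set.Icc 0 (2 * Real.pi) | A * Real.cos (n / 2 * t + φ) +
      B * Real.cos ((n / 2 + 1) * t + ψ) = 0}.encard + 1 := by
  have habs : ∀ {R : ℝ}, 0 ≤ R → ∀ x, |R * Real.cos x| ≤ R := fun {R} hR x => by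
    rw [abs_mul, abs_of_nonneg hR]
    exact mul_le_of_le_one_right hR (Real.abs_cos_le_one x)
  rcases lt_trichotomy B A with hlt | rfl | hlt
  · exact le_encard_zeros_mul_cos_add (by fun_prop) fun t => (habs hB _).trans_lt hlt
  · have hsub : {t ∈ Set.Ico 0 (2 * Real.pi) |
        Real.cos (((n + 1 : ℕ) : ℝ) / 2 * t + (φ + ψ) / 2) = 0} ⊆
        {t ∈ Set.Icc 0 (2 * Real.pi) | B * Real.cos (n / 2 * t + φ) +
          B * Real.cos ((n / 2 + 1) * t + ψ) = 0} := fun t ht => by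
      have hmid : (n / 2 * t + φ + ((n / 2 + 1) * t + ψ)) / 2 =
          ((n + 1 : ℕ) : ℝ) / 2 * t + (φ + ψ) / 2 := by
        push_cast
        ring
      refine ⟨Set.Ico_subset_Icc_self ht.1, ?_⟩
      rw [← mul_add, Real.cos_add_cos, hmid, ht.2, mul_zero, zero_mul, mul_zero]
    calc (n : ℕ∞) ≤ ((n + 1 : ℕ) : ℕ∞) := by exact_mod_cast n.le_succ
      _ ≤ _ := le_encard_zeros_cos (n + 1) ((φ + ψ) / 2)
      _ ≤ _ := Set.encard_le_encard hsub
      _ ≤ _ := le_self_add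
  · calc (n : ℕ∞) ≤ ((n + 2 : ℕ) : ℕ∞) := by exact_mod_cast n.le_add_right 2
      _ ≤ _ := le_encard_zeros_mul_cos_add (φ := ψ) (r := fun t => A * Real.cos (n / 2 * t + φ))
        (by fun_prop) fun t => (habs hA _).trans_lt hlt
      _ = _ := by
        have hhalf : ((n + 2 : ℕ) : ℝ) / 2 = n / 2 + 1 := by
          push_cast
          ring
        simp only [hhalf, add_comm]

theorem re_mul_exp_ofReal_mul_I (w : ℂ) (x : ℝ) :
    (w * Complex.exp (x * Complex.I)).re = ‖w‖ * Real.cos (x + w.arg) := by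
  conv_lhs => rw [← Complex.norm_mul_exp_arg_mul_I w, mul_assoc, ← Complex.exp_add, ← add_mul,
    ← Complex.ofReal_add, Complex.re_ofReal_mul, Complex.exp_ofReal_mul_I_re, add_comm]

theorem im_mul_exp_ofReal_mul_I (w : ℂ) (x : ℝ) :
    (w * Complex.exp (x * Complex.I)).im = ‖w‖ * Real.sin (x + w.arg) := by
  conv_lhs => rw [← Complex.norm_mul_exp_arg_mul_I w, mul_assoc, ← Complex.exp_add, ← add_mul,
    ← Complex.ofReal_add, Complex.im_ofReal_mul, Complex.exp_ofReal_mul_I_im, add_comm]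

theorem le_encard_zeros_im_mul_exp (n : ℕ) (w z : ℂ) (θ : ℝ) :
    (n : ℕ∞) ≤ {t ∈ Set.Icc 0 (2 * Real.pi) | ((w - z * Complex.exp (t * Complex.I)) *
      Complex.exp ((n / 2 * t + θ : ℝ) * Complex.I)).im = 0}.encard + 1 := by
  convert le_encard_zeros_cos_add_cos n (norm_nonneg w) (norm_nonneg z)
    (θ + w.arg - Real.pi / 2) (θ + z.arg + Real.pi / 2) using 6 with t
  have hexp : Complex.exp (t * Complex.I) * Complex.exp ((n / 2 * t + θ : ℝ) * Complex.I) =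
      Complex.exp (((n / 2 + 1) * t + θ : ℝ) * Complex.I) := by
    rw [← Complex.exp_add]
    push_cast
    ring_nf
  rw [sub_mul, mul_assoc, hexp, Complex.sub_im, im_mul_exp_ofReal_mul_I, im_mul_exp_ofReal_mul_I,
    ← add_sub_assoc, Real.cos_sub_pi_div_two, ← add_assoc _ _ (Real.pi / 2),
    Real.cos_add_pi_div_two, ← add_assoc, ← add_assoc, mul_neg, ← sub_eq_add_neg]

end Zeros

section TrigSum

/-- The exponential sum `∑_{k=1}^n c_k e^{ikt}`; its real part is the trigonometric polynomial
whose cosine and sine coefficients are the real parts and the negated imaginary parts of `c`. -/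
noncomputable def trigSum (c : ℕ → ℂ) (n : ℕ) (t : ℝ) : ℂ :=
  ∑ k ∈ Finset.Icc 1 n, c k * Complex.exp (t * Complex.I) ^ k

theorem trigSum_congr {c d : ℕ → ℂ} (h : Set.EqOn c d (Set.Ici 1)) (n : ℕ) :
    trigSum c n = trigSum d n :=
  funext fun t => Finset.sum_congr rfl fun k hk => by rw [h (Finset.mem_Icc.1 hk).1]

theorem exp_ofReal_mul_I_pow (t : ℝ) (n : ℕ) :
    Complex.exp (t * Complex.I) ^ n = Complex.exp ((n * t : ℝ) * Complex.I) := by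
  rw [← Complex.exp_nat_mul]
  push_cast
  ring_nf

theorem one_sub_exp_ofReal_mul_I (x : ℝ) : 1 - Complex.exp (x * Complex.I) =
    -2 * Complex.I * Real.sin (x / 2) * Complex.exp ((x / 2 : ℝ) * Complex.I) := by
  have hsin := Complex.two_sin (x / 2)
  have hsq : Complex.exp (x * Complex.I) = Complex.exp (x / 2 * Complex.I) ^ 2 := by
    rw [← Complex.exp_nat_mul]
    push_cast
    ring_nf
  have hinv : Complex.exp (-(x / 2) * Complex.I) * Complex.exp (x / 2 * Complex.I) = 1 := by
    rw [neg_mul, Complex.exp_neg, inv_mul_cancel₀ (Complex.exp_ne_zero _)]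
  push_cast
  linear_combination -hsq + Complex.I * Complex.exp (x / 2 * Complex.I) * hsin - hinv +
    (Complex.exp (-(x / 2) * Complex.I) - Complex.exp (x / 2 * Complex.I)) *
      Complex.exp (x / 2 * Complex.I) * Complex.I_sq

section Periodic

variable {c : ℕ → ℂ} {q n : ℕ}

theorem trigSum_add_of_periodic (hc : Function.Periodic c q) (n : ℕ) (t : ℝ) :
    trigSum c (n + q) t = trigSum c q t + Complex.exp (t * Complex.I) ^ q * trigSum c n t := by
  induction n with
  | zero => simp [trigSum]
  | succ n ih =>
    rw [trigSum, add_right_comm, Finset.sum_Icc_succ_top (by omega), ← trigSum, ih,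
      add_right_comm n q 1, hc, trigSum, trigSum, trigSum, Finset.sum_Icc_succ_top (by omega)]
    ring

theorem one_sub_pow_mul_trigSum_of_dvd (hc : Function.Periodic c q) (hqn : q ∣ n) (t : ℝ) :
    (1 - Complex.exp (t * Complex.I) ^ q) * trigSum c n t =
      (1 - Complex.exp (t * Complex.I) ^ n) * trigSum c q t := by
  obtain ⟨m, rfl⟩ := hqn
  induction m with
  | zero => simp [trigSum]
  | succ m ih =>
    rw [mul_add_one, trigSum_add_of_periodic hc, pow_add]
    linear_combination Complex.exp (t * Complex.I) ^ q * ih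

theorem sin_mul_trigSum_of_dvd (hc : Function.Periodic c q) (hqn : q ∣ n) (t : ℝ) :
    Real.sin (q * t / 2) * trigSum c n t = Real.sin (n * t / 2) *
      (Complex.exp (((n - q) * t / 2 : ℝ) * Complex.I) * trigSum c q t) := by
  have h := one_sub_pow_mul_trigSum_of_dvd hc hqn t
  simp only [exp_ofReal_mul_I_pow, one_sub_exp_ofReal_mul_I] at h
  have hexp : Complex.exp ((n * t / 2 : ℝ) * Complex.I) =
      Complex.exp ((q * t / 2 : ℝ) * Complex.I) *
        Complex.exp (((n - q) * t / 2 : ℝ) * Complex.I) := by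
    rw [← Complex.exp_add]
    push_cast
    ring_nf
  rw [hexp] at h
  have hne : -2 * Complex.I * Complex.exp ((q * t / 2 : ℝ) * Complex.I) ≠ 0 := by
    simp [Complex.exp_ne_zero]
  refine mul_left_cancel₀ hne ?_
  linear_combination h

end Periodic

theorem sum_mul_of_recurrence {R : Type*} [CommRing R] {c : ℕ → R} {p : R}
    (hc : ∀ k, c (k + 2) = p * c (k + 1) - c k) (z : R) (n : ℕ) :
    (1 - p * z + z ^ 2) * ∑ k ∈ Finset.Icc 1 n, c k * z ^ k =
      c 1 * z - c 0 * z ^ 2 - c (n + 1) * z ^ (n + 1) + c n * z ^ (n + 2) := by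
  induction n with
  | zero => simp
  | succ n ih =>
    rw [Finset.sum_Icc_succ_top (by omega), mul_add, ih, hc n]
    ring

/-- The sequence `k ↦ A cos (k α) + B sin (k α)`, the form taken almost surely by the coefficients
of a Gaussian process with correlation function `k ↦ cos (k α)`. -/
noncomputable def cosineSeq (α : ℝ) (A B : ℂ) (k : ℕ) : ℂ :=
  A * Real.cos (k * α) + B * Real.sin (k * α)

section CosineSeq

variable {α : ℝ} (A B : ℂ)

theorem cosineSeq_zero : cosineSeq 0 A B = fun _ => A := by
  funext k
  simp [cosineSeq]

theorem cosineSeq_add_two (k : ℕ) : cosineSeq α A B (k + 2) =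
    2 * Real.cos α * cosineSeq α A B (k + 1) - cosineSeq α A B k := by
  simp only [cosineSeq]
  push_cast
  rw [show ((k : ℂ) + 2) * α = (k + 1) * α + α by ring, show (k : ℂ) * α = (k + 1) * α - α by ring,
    Complex.cos_add, Complex.sin_add, Complex.cos_sub, Complex.sin_sub]
  ring

variable {A B}

theorem cosineSeq_add_of_sin_eq_zero {n : ℕ} (hn : Real.sin (n * α) = 0) (k : ℕ) :
    cosineSeq α A B (k + n) = Real.cos (n * α) * cosineSeq α A B k := by
  simp only [cosineSeq]
  push_cast
  have hn' : Complex.sin (n * α) = 0 := by exact_mod_cast congrArg Complex.ofReal hn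
  rw [add_mul, Complex.cos_add, Complex.sin_add, hn']
  ring

theorem two_mul_cos_sub_mul_trigSum {n : ℕ} (hn : Real.sin (n * α) = 0) (t : ℝ) :
    2 * (Real.cos t - Real.cos α) * trigSum (cosineSeq α A B) n t =
      (cosineSeq α A B 1 - cosineSeq α A B 0 * Complex.exp (t * Complex.I)) *
        (1 - Complex.exp ((n * t + n * α : ℝ) * Complex.I)) := by
  have hsum := sum_mul_of_recurrence (cosineSeq_add_two (α := α) A B)
    (Complex.exp (t * Complex.I)) n
  have hcos : Complex.exp ((n * t + n * α : ℝ) * Complex.I) =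
      Complex.exp (t * Complex.I) ^ n * Real.cos (n * α) := by
    rw [exp_ofReal_mul_I_pow, Complex.ofReal_add, add_mul, Complex.exp_add]
    congr 1
    rw [Complex.exp_mul_I, ← Complex.ofReal_cos, ← Complex.ofReal_sin, hn, Complex.ofReal_zero,
      zero_mul, add_zero]
  have hquad : 2 * (Real.cos t : ℂ) * Complex.exp (t * Complex.I) =
      1 + Complex.exp (t * Complex.I) ^ 2 := by
    rw [Complex.ofReal_cos, Complex.two_cos, add_mul, neg_mul, Complex.exp_neg,
      inv_mul_cancel₀ (Complex.exp_ne_zero _)]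
    ring
  have hlast : cosineSeq α A B n = Real.cos (n * α) * cosineSeq α A B 0 := by
    rw [← cosineSeq_add_of_sin_eq_zero hn, zero_add]
  rw [add_comm n 1, cosineSeq_add_of_sin_eq_zero hn, hlast, ← trigSum] at hsum
  refine mul_left_cancel₀ (Complex.exp_ne_zero (t * Complex.I)) ?_
  rw [hcos]
  linear_combination hsum + trigSum (cosineSeq α A B) n t * hquad

theorem cos_sub_mul_re_exp_mul_trigSum {n : ℕ} (hn : Real.sin (n * α) = 0) (s t : ℝ) :
    (Real.cos t - Real.cos α) *
        (Complex.exp (s * Complex.I) * trigSum (cosineSeq α A B) n t).re =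
      Real.sin (n / 2 * t + n / 2 * α) *
        ((cosineSeq α A B 1 - cosineSeq α A B 0 * Complex.exp (t * Complex.I)) *
          Complex.exp ((s + n / 2 * t + n / 2 * α : ℝ) * Complex.I)).im := by
  set D := cosineSeq α A B 1 - cosineSeq α A B 0 * Complex.exp (t * Complex.I)
  have hexp : Complex.exp ((s + n / 2 * t + n / 2 * α : ℝ) * Complex.I) =
      Complex.exp (s * Complex.I) * Complex.exp ((n / 2 * t + n / 2 * α : ℝ) * Complex.I) := by
    rw [← Complex.exp_add]
    push_cast
    ring_nf
  have hhalf : (n * t + n * α) / 2 = n / 2 * t + n / 2 * α := by ring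
  have h := two_mul_cos_sub_mul_trigSum (A := A) (B := B) hn t
  rw [one_sub_exp_ofReal_mul_I, hhalf] at h
  have hcomplex : ((Real.cos t - Real.cos α : ℝ) : ℂ) *
      (Complex.exp (s * Complex.I) * trigSum (cosineSeq α A B) n t) =
      (Real.sin (n / 2 * t + n / 2 * α) : ℂ) *
        (-Complex.I * (D * Complex.exp ((s + n / 2 * t + n / 2 * α : ℝ) * Complex.I))) := by
    rw [hexp, Complex.ofReal_sub]
    linear_combination Complex.exp (s * Complex.I) / 2 * h
  have hre := congrArg Complex.re hcomplex
  rw [Complex.re_ofReal_mul, Complex.re_ofReal_mul] at hre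
  rw [hre]
  simp

end CosineSeq

end TrigSum

section TrigSumPoly

variable {c : ℕ → ℂ} {n : ℕ}

open Polynomial in
/-- The polynomial `P` of degree at most `2n` with
`P(e^{it}) = 2 e^{int} Re (∑_{k=1}^n c_k e^{ikt})`. -/
noncomputable def trigSumPoly (c : ℕ → ℂ) (n : ℕ) : ℂ[X] :=
  ∑ k ∈ Finset.Icc 1 n, (C (c k) * X ^ (n + k) + C ((starRingEnd ℂ) (c k)) * X ^ (n - k))

theorem coeff_trigSumPoly_add {k : ℕ} (hk : k ∈ Finset.Icc 1 n) :
    (trigSumPoly c n).coeff (n + k) = c k := by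
  simp only [trigSumPoly, Polynomial.finsetSum_coeff, Polynomial.coeff_add,
    Polynomial.coeff_C_mul, Polynomial.coeff_X_pow]
  have hk1 := (Finset.mem_Icc.1 hk).1
  rw [Finset.sum_eq_single_of_mem k hk fun j _ hjk => by
    rw [if_neg (by omega), if_neg (by omega), mul_zero, mul_zero, add_zero]]
  rw [if_pos rfl, if_neg (by omega), mul_one, mul_zero, add_zero]

theorem natDegree_trigSumPoly_le (c : ℕ → ℂ) (n : ℕ) : (trigSumPoly c n).natDegree ≤ 2 * n := by
  refine Polynomial.natDegree_sum_le_of_forall_le _ _ fun k hk => ?_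
  have hkn := (Finset.mem_Icc.1 hk).2
  exact Polynomial.natDegree_add_le_of_degree_le
    ((Polynomial.natDegree_C_mul_X_pow_le _ _).trans (by omega))
    ((Polynomial.natDegree_C_mul_X_pow_le _ _).trans (by omega))

theorem eval_trigSumPoly (c : ℕ → ℂ) (n : ℕ) (t : ℝ) :
    (trigSumPoly c n).eval (Complex.exp (t * Complex.I)) =
      Complex.exp (t * Complex.I) ^ n * (2 * (trigSum c n t).re : ℝ) := by
  have hconj : (starRingEnd ℂ) (Complex.exp (t * Complex.I)) =
      (Complex.exp (t * Complex.I))⁻¹ := by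
    rw [← Complex.exp_conj, ← Complex.exp_neg, map_mul, Complex.conj_ofReal, Complex.conj_I,
      mul_neg]
  rw [← Complex.add_conj, trigSum, trigSumPoly, Polynomial.eval_finsetSum, map_sum,
    ← Finset.sum_add_distrib, Finset.mul_sum]
  refine Finset.sum_congr rfl fun k hk => ?_
  simp only [Polynomial.eval_add, Polynomial.eval_mul, Polynomial.eval_C, Polynomial.eval_pow,
    Polynomial.eval_X, map_mul, map_pow, hconj]
  rw [pow_sub₀ _ (Complex.exp_ne_zero _) (Finset.mem_Icc.1 hk).2, pow_add, inv_pow]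
  ring

theorem encard_zeros_re_trigSum_Ico_le (hc : ∃ k ∈ Finset.Icc 1 n, c k ≠ 0) :
    {t ∈ Set.Ico 0 (2 * Real.pi) | (trigSum c n t).re = 0}.encard ≤ ((2 * n : ℕ) : ℕ∞) := by
  have hP : trigSumPoly c n ≠ 0 := by
    obtain ⟨k, hk, hck⟩ := hc
    intro hP
    rw [← coeff_trigSumPoly_add (c := c) hk, hP, Polynomial.coeff_zero] at hck
    exact hck rfl
  have hroot : Set.MapsTo (fun t : ℝ => Complex.exp (t * Complex.I))
      {t ∈ Set.Ico 0 (2 * Real.pi) | (trigSum c n t).re = 0}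
      ((trigSumPoly c n).roots.toFinset : Set ℂ) := fun t ht => by
    rw [Finset.mem_coe, Multiset.mem_toFinset, Polynomial.mem_roots hP, Polynomial.IsRoot.def,
      eval_trigSumPoly, ht.2, mul_zero, Complex.ofReal_zero, mul_zero]
  have hinj : Set.InjOn (fun t : ℝ => Complex.exp (t * Complex.I)) (Set.Ico 0 (2 * Real.pi)) := by
    refine (injOn_circleMap_of_abs_sub_le' (c := 0) one_ne_zero (sub_zero (2 * Real.pi)).le).congr
      fun t _ => ?_
    rw [circleMap_zero, Complex.ofReal_one, one_mul]
  calc _ ≤ ((trigSumPoly c n).roots.toFinset : Set ℂ).encard :=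
        Set.encard_le_encard_of_injOn hroot (hinj.mono fun t ht => ht.1)
    _ = (trigSumPoly c n).roots.toFinset.card := Set.encard_coe_eq_coe_finsetCard _
    _ ≤ ((2 * n : ℕ) : ℕ∞) := by
      exact_mod_cast (Multiset.toFinset_card_le _).trans
        ((Polynomial.card_roots' _).trans (natDegree_trigSumPoly_le c n))

theorem zeroCount_re_trigSum_le (hc : ∃ k ∈ Finset.Icc 1 n, c k ≠ 0) :
    zeroCount (fun t => (trigSum c n t).re) ≤ ((2 * n + 1 : ℕ) : ℕ∞) := by
  have hsub : {t ∈ Set.Icc 0 (2 * Real.pi) | (trigSum c n t).re = 0} ⊆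
      insert (2 * Real.pi) {t ∈ Set.Ico 0 (2 * Real.pi) | (trigSum c n t).re = 0} := by
    rintro t ⟨ht, h0⟩
    rcases ht.2.lt_or_eq with hlt | heq
    exacts [Or.inr ⟨⟨ht.1, hlt⟩, h0⟩, Or.inl heq]
  calc _ ≤ _ := Set.encard_le_encard hsub
    _ ≤ _ := Set.encard_insert_le _ _
    _ ≤ ((2 * n : ℕ) : ℕ∞) + 1 := by
      gcongr
      exact encard_zeros_re_trigSum_Ico_le hc
    _ = ((2 * n + 1 : ℕ) : ℕ∞) := by push_cast; rfl

end TrigSumPoly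

section ZeroCount

/-- Genericity of the coefficients: on no rational angle `rπ` does the phase of `c_1` or of
`c_1 - c_0 e^{irπ}` take the exceptional value for which the two factors of the trigonometric
polynomial vanish simultaneously. For the latter, the angles with `cos (rπ) = cos α` are exempt. -/
structure IsGenericCosineSeq (α : ℝ) (c : ℕ → ℂ) : Prop where
  re_ne_zero : ∀ r : ℚ, (c 1 * Complex.exp ((r * Real.pi : ℝ) * Complex.I)).re ≠ 0
  im_ne_zero : ∀ r : ℚ, Real.cos (r * Real.pi) ≠ Real.cos α →
    (c 1 - c 0 * Complex.exp ((r * Real.pi : ℝ) * Complex.I)).im ≠ 0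

variable {α : ℝ} {A B : ℂ} {n : ℕ}

theorem IsGenericCosineSeq.one_ne_zero {c : ℕ → ℂ} (h : IsGenericCosineSeq α c) : c 1 ≠ 0 :=
  fun h0 => h.re_ne_zero 0 (by simp [h0])

theorem exists_rat_of_sin_half_eq_zero (hn : 0 < n) (hα : Real.sin (n * α) = 0) {t : ℝ}
    (ht : Real.sin (n / 2 * t + n / 2 * α) = 0) : ∃ r : ℚ, t = r * Real.pi := by
  obtain ⟨k, hk⟩ := Real.sin_eq_zero_iff.1 ht
  obtain ⟨j, hj⟩ := Real.sin_eq_zero_iff.1 hα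
  refine ⟨(2 * k - j) / n, ?_⟩
  push_cast
  field_simp
  linarith

theorem IsGenericCosineSeq.cos_eq_of_common_zero (h : IsGenericCosineSeq α (cosineSeq α A B))
    (hn : 0 < n) (hα : Real.sin (n * α) = 0) {t : ℝ}
    (hsin : Real.sin (n / 2 * t + n / 2 * α) = 0)
    (him : ((cosineSeq α A B 1 - cosineSeq α A B 0 * Complex.exp (t * Complex.I)) *
      Complex.exp ((n / 2 * t + n / 2 * α : ℝ) * Complex.I)).im = 0) :
    Real.cos t = Real.cos α := by
  obtain ⟨r, rfl⟩ := exists_rat_of_sin_half_eq_zero hn hα hsin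
  by_contra hcos
  refine h.im_ne_zero r hcos ?_
  rw [Complex.mul_im, Complex.exp_ofReal_mul_I_im, Complex.exp_ofReal_mul_I_re, hsin, mul_zero,
    zero_add, mul_eq_zero] at him
  refine him.resolve_right fun h0 => ?_
  simpa [hsin, h0] using Real.sin_sq_add_cos_sq (n / 2 * (r * Real.pi) + n / 2 * α)

theorem IsGenericCosineSeq.le_zeroCount_re_trigSum_add
    (h : IsGenericCosineSeq α (cosineSeq α A B)) (hn : 0 < n) (hα : Real.sin (n * α) = 0) :
    ((2 * n : ℕ) : ℕ∞) ≤ zeroCount (fun t => (trigSum (cosineSeq α A B) n t).re) + 5 := by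
  set g : ℝ → ℝ := fun t => Real.sin (n / 2 * t + n / 2 * α)
  set H : ℝ → ℝ := fun t =>
    ((cosineSeq α A B 1 - cosineSeq α A B 0 * Complex.exp (t * Complex.I)) *
      Complex.exp ((n / 2 * t + n / 2 * α : ℝ) * Complex.I)).im
  have hfact : ∀ t ∈ Set.Icc 0 (2 * Real.pi),
      (Real.cos t - Real.cos α) * (trigSum (cosineSeq α A B) n t).re = g t * H t := fun t _ => by
    simpa only [Complex.ofReal_zero, zero_mul, Complex.exp_zero, one_mul, zero_add] using
      cos_sub_mul_re_exp_mul_trigSum hα 0 t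
  have hg : (n : ℕ∞) ≤ {t ∈ Set.Icc 0 (2 * Real.pi) | g t = 0}.encard :=
    (le_encard_zeros_sin n _).trans
      (Set.encard_le_encard fun t ht => ⟨Set.Ico_subset_Icc_self ht.1, ht.2⟩)
  have hH : (n : ℕ∞) ≤ {t ∈ Set.Icc 0 (2 * Real.pi) | H t = 0}.encard + 1 :=
    le_encard_zeros_im_mul_exp n _ _ _
  have hcos := encard_zeros_cos_sub_le (Real.cos α)
  have hsub : {t ∈ Set.Icc 0 (2 * Real.pi) | g t = 0 ∧ H t = 0} ⊆
      {t ∈ Set.Icc 0 (2 * Real.pi) | Real.cos t - Real.cos α = 0} := fun t ht =>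
    ⟨ht.1, sub_eq_zero.2 (h.cos_eq_of_common_zero hn hα ht.2.1 ht.2.2)⟩
  have hcommon := (Set.encard_le_encard hsub).trans hcos
  calc ((2 * n : ℕ) : ℕ∞) = n + n := by push_cast; ring
    _ ≤ _ := add_le_add hg hH
    _ = _ := (add_assoc _ _ _).symm
    _ ≤ _ := add_le_add_left (encard_zeros_add_encard_zeros_le_of_mul_eq hfact) 1
    _ ≤ zeroCount (fun t => (trigSum (cosineSeq α A B) n t).re) + 2 + 2 + 1 := by
      gcongr
      rfl
    _ = _ := by ring

theorem le_zeroCount_re_exp_mul_trigSum_add {q : ℕ} (hα : Real.sin (q * α) = 0) :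
    (n : ℕ∞) ≤ zeroCount (fun t => (Complex.exp (((n - q) * t / 2 : ℝ) * Complex.I) *
      trigSum (cosineSeq α A B) q t).re) + 3 := by
  set f : ℝ → ℝ := fun t => (Complex.exp (((n - q) * t / 2 : ℝ) * Complex.I) *
    trigSum (cosineSeq α A B) q t).re
  have hsub : {t ∈ Set.Icc 0 (2 * Real.pi) |
      ((cosineSeq α A B 1 - cosineSeq α A B 0 * Complex.exp (t * Complex.I)) *
        Complex.exp ((n / 2 * t + q / 2 * α : ℝ) * Complex.I)).im = 0} ⊆
      {t ∈ Set.Icc 0 (2 * Real.pi) | f t = 0} ∪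
        {t ∈ Set.Icc 0 (2 * Real.pi) | Real.cos t - Real.cos α = 0} := fun t ht => by
    have hfact := cos_sub_mul_re_exp_mul_trigSum (A := A) (B := B) hα ((n - q) * t / 2) t
    rw [show (n - q) * t / 2 + q / 2 * t + q / 2 * α = n / 2 * t + q / 2 * α by ring, ht.2,
      mul_zero, mul_eq_zero] at hfact
    exact hfact.symm.imp (⟨ht.1, ·⟩) (⟨ht.1, ·⟩)
  calc (n : ℕ∞) ≤ _ := le_encard_zeros_im_mul_exp n _ _ _
    _ ≤ zeroCount f + 2 + 1 := by
      gcongr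
      exact ((Set.encard_le_encard hsub).trans (Set.encard_union_le _ _)).trans
        (add_le_add_right (encard_zeros_cos_sub_le _) _)
    _ = _ := by rw [add_assoc, two_add_one_eq_three]

theorem sin_half_mul_re_trigSum_const (A : ℂ) (n : ℕ) (t : ℝ) :
    Real.sin (t / 2) * (trigSum (fun _ => A) n t).re =
      Real.sin (n / 2 * t) * (A * Complex.exp (((n + 1 : ℕ) / 2 * t : ℝ) * Complex.I)).re := by
  have hexp : Complex.exp (((n + 1 : ℕ) / 2 * t : ℝ) * Complex.I) =
      Complex.exp (((n - (1 : ℕ)) * t / 2 : ℝ) * Complex.I) * Complex.exp (t * Complex.I) := by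
    rw [← Complex.exp_add]
    push_cast
    ring_nf
  have hone : trigSum (fun _ => A) 1 t = A * Complex.exp (t * Complex.I) := by simp [trigSum]
  have h := sin_mul_trigSum_of_dvd (c := fun _ => A) (q := 1) (fun _ => rfl) (one_dvd n) t
  rw [hone, mul_left_comm (Complex.exp _) A, ← hexp, Nat.cast_one, one_mul, mul_div_right_comm] at h
  simpa only [Complex.re_ofReal_mul] using congrArg Complex.re h

theorem le_encard_zeros_re_trigSum_const (hn : 0 < n)
    (hA : ∀ r : ℚ, (A * Complex.exp ((r * Real.pi : ℝ) * Complex.I)).re ≠ 0) :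
    ((2 * n : ℕ) : ℕ∞) ≤
      {t ∈ Set.Ico 0 (2 * Real.pi) | (trigSum (fun _ => A) n t).re = 0}.encard := by
  set g : ℝ → ℝ := fun t => Real.sin (n / 2 * t + 0)
  set H : ℝ → ℝ := fun t => (A * Complex.exp (((n + 1 : ℕ) / 2 * t : ℝ) * Complex.I)).re
  have hfact : ∀ t ∈ Set.Ico 0 (2 * Real.pi),
      Real.sin (t / 2) * (trigSum (fun _ => A) n t).re = g t * H t := fun t _ => by
    rw [sin_half_mul_re_trigSum_const, ← add_zero (n / 2 * t)]
  have hg : (n : ℕ∞) ≤ {t ∈ Set.Ico 0 (2 * Real.pi) | g t = 0}.encard := le_encard_zeros_sin n 0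
  have hH : ((n + 1 : ℕ) : ℕ∞) ≤ {t ∈ Set.Ico 0 (2 * Real.pi) | H t = 0}.encard :=
    (le_encard_zeros_cos (n + 1) A.arg).trans (Set.encard_le_encard fun t ht =>
      ⟨ht.1, (re_mul_exp_ofReal_mul_I _ _).trans (by rw [ht.2, mul_zero])⟩)
  have hp : {t ∈ Set.Ico 0 (2 * Real.pi) | Real.sin (t / 2) = 0}.encard ≤ 1 := by
    refine Set.encard_le_one_iff_subsingleton.2 (Set.subsingleton_of_subset_singleton (a := 0) ?_)
    rintro t ⟨⟨h0, h2⟩, ht⟩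
    rw [Real.sin_eq_zero_iff_of_lt_of_lt (by linarith) (by linarith)] at ht
    rw [Set.mem_singleton_iff]
    linarith
  have hcommon : {t ∈ Set.Ico 0 (2 * Real.pi) | g t = 0 ∧ H t = 0} = ∅ := by
    refine Set.eq_empty_of_forall_notMem fun t ⟨_, hgt, hHt⟩ => ?_
    obtain ⟨r, rfl⟩ := exists_rat_of_sin_half_eq_zero (α := 0) (t := t) hn
      (by rw [mul_zero, Real.sin_zero]) (by rwa [mul_zero])
    refine hA ((n + 1 : ℕ) / 2 * r) ?_
    rwa [show (((n + 1 : ℕ) / 2 * r : ℚ) : ℝ) * Real.pi = (n + 1 : ℕ) / 2 * (r * Real.pi) by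
      push_cast
      ring]
  have hle := encard_zeros_add_encard_zeros_le_of_mul_eq hfact
  rw [hcommon, Set.encard_empty, add_zero] at hle
  refine (ENat.add_le_add_iff_right ENat.one_ne_top).1 ?_
  calc ((2 * n : ℕ) : ℕ∞) + 1 = n + (n + 1 : ℕ) := by push_cast; ring
    _ ≤ _ := (add_le_add hg hH).trans hle
    _ ≤ _ := by gcongr

theorem zeroCount_re_trigSum_const (hn : 0 < n)
    (hA : ∀ r : ℚ, (A * Complex.exp ((r * Real.pi : ℝ) * Complex.I)).re ≠ 0) :
    zeroCount (fun t => (trigSum (fun _ => A) n t).re) = ((2 * n : ℕ) : ℕ∞) := by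
  have hre : A.re ≠ 0 := by simpa using hA 0
  have hend : (trigSum (fun _ => A) n (2 * Real.pi)).re ≠ 0 := by
    simp [trigSum, Complex.exp_two_pi_mul_I, hn.ne', hre]
  have hIco : {t ∈ Set.Icc 0 (2 * Real.pi) | (trigSum (fun _ => A) n t).re = 0} =
      {t ∈ Set.Ico 0 (2 * Real.pi) | (trigSum (fun _ => A) n t).re = 0} := by
    ext t
    refine ⟨fun ⟨ht, h0⟩ => ⟨⟨ht.1, ht.2.lt_of_ne ?_⟩, h0⟩, fun ⟨ht, h0⟩ =>
      ⟨Set.Ico_subset_Icc_self ht, h0⟩⟩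
    rintro rfl
    exact hend h0
  rw [zeroCount, hIco]
  refine le_antisymm (encard_zeros_re_trigSum_Ico_le ⟨1, Finset.mem_Icc.2 ⟨le_rfl, hn⟩, ?_⟩)
    (le_encard_zeros_re_trigSum_const hn hA)
  rintro rfl
  exact hre rfl

end ZeroCount

section Measurability

theorem nullMeasurableSet_exists_mem_eq_zero {Ω X : Type*} [MeasurableSpace Ω] {P : Measure Ω}
    [TopologicalSpace X] [SecondCountableTopology X] {K : Set X} {F : Ω → X → ℝ}
    (hK : IsCompact K) (hF : ∀ ω, ContinuousOn (F ω) K)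
    (hm : ∀ t ∈ K, AEMeasurable (fun ω => F ω t) P) :
    NullMeasurableSet {ω | ∃ t ∈ K, F ω t = 0} P := by
  obtain ⟨D, hDc, hD⟩ := TopologicalSpace.exists_countable_dense K
  -- By compactness, `F ω` vanishes somewhere on `K` iff `|F ω|` is arbitrarily small there.
  have hdense : {ω | ∃ t ∈ K, F ω t = 0} =
      ⋂ m : ℕ, ⋃ s ∈ D, {ω | |F ω s| < 1 / ((m : ℝ) + 1)} := by
    ext ω
    simp only [Set.mem_ofPred_eq, Set.mem_iInter, Set.mem_iUnion, exists_prop]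
    constructor
    · rintro ⟨t, ht, h0⟩ m
      have hopen : IsOpen {s : K | |F ω s| < 1 / ((m : ℝ) + 1)} :=
        isOpen_lt (hF ω).domRestrict.abs continuous_const
      have hsmall : |F ω t| < 1 / ((m : ℝ) + 1) := by
        rw [h0, abs_zero]
        positivity
      obtain ⟨s, hsD, hs⟩ := hD.exists_mem_open hopen ⟨⟨t, ht⟩, hsmall⟩
      exact ⟨s, hsD, hs⟩
    · intro hsmall
      obtain ⟨s₀, -, -⟩ := hsmall 0
      obtain ⟨t, ht, hmin⟩ := hK.exists_isMinOn ⟨s₀, s₀.2⟩ (hF ω).abs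
      refine ⟨t, ht, by_contra fun hne => ?_⟩
      obtain ⟨m, hlt⟩ := exists_nat_one_div_lt (abs_pos.2 hne)
      obtain ⟨s, -, hs⟩ := hsmall m
      exact (hmin s.2).not_gt (hs.trans hlt)
  rw [hdense]
  exact NullMeasurableSet.iInter fun m => NullMeasurableSet.biUnion hDc fun s _ =>
    nullMeasurableSet_lt (hm s s.2).abs aemeasurable_const

theorem natCast_le_encard_iff_exists_pairwiseDisjoint_Icc {Z : Set ℝ} {k : ℕ} :
    (k : ℕ∞) ≤ Z.encard ↔ ∃ s : Finset (ℚ × ℚ), s.card = k ∧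
      (s : Set (ℚ × ℚ)).PairwiseDisjoint (fun i => Set.Icc (i.1 : ℝ) i.2) ∧
      ∀ i ∈ s, (Z ∩ Set.Icc (i.1 : ℝ) i.2).Nonempty := by
  constructor
  · intro hk
    obtain ⟨T, hTZ, hTk⟩ := Set.exists_subset_encard_eq hk
    have hTfin : T.Finite := Set.finite_of_encard_eq_coe hTk
    lift T to Finset ℝ using hTfin
    rw [Set.encard_coe_eq_coe_finsetCard, Nat.cast_inj] at hTk
    obtain ⟨U, hU, hdisj⟩ := T.finite_toSet.t2_separation
    have hrat : ∀ t : ℝ, ∃ i : ℚ × ℚ,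
        t ∈ Set.Icc (i.1 : ℝ) i.2 ∧ Set.Icc (i.1 : ℝ) i.2 ⊆ U t := fun t => by
      obtain ⟨l, r, ht, hlr⟩ := mem_nhds_iff_exists_Ioo_subset.1 ((hU t).2.mem_nhds (hU t).1)
      obtain ⟨p, hlp, hpt⟩ := exists_rat_btwn ht.1
      obtain ⟨q, htq, hqr⟩ := exists_rat_btwn ht.2
      exact ⟨(p, q), ⟨hpt.le, htq.le⟩, (Set.Icc_subset_Ioo hlp hqr).trans hlr⟩
    choose φ hφ hφU using hrat
    have hinj : Set.InjOn φ T := fun x hx y hy hxy => hdisj.elim hx hy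
      (Set.not_disjoint_iff.2 ⟨x, hφU x (hφ x), hφU y (hxy ▸ hφ x)⟩)
    refine ⟨T.image φ, (Finset.card_image_of_injOn hinj).trans hTk, ?_, fun i hi => ?_⟩
    · rw [Finset.coe_image, hinj.pairwiseDisjoint_image]
      exact hdisj.mono hφU
    · obtain ⟨t, ht, rfl⟩ := Finset.mem_image.1 hi
      exact ⟨t, hTZ ht, hφ t⟩
  · rintro ⟨s, rfl, hdisj, hne⟩
    choose! z hz using hne
    have hinj : Set.InjOn z s := fun i hi j hj hij => hdisj.elim hi hj
      (Set.not_disjoint_iff.2 ⟨z i, (hz i hi).2, hij ▸ (hz j hj).2⟩)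
    rw [← Set.encard_coe_eq_coe_finsetCard]
    exact Set.encard_le_encard_of_injOn (fun i hi => (hz i hi).1) hinj

theorem aemeasurable_toENNReal_of_nullMeasurableSet_le {Ω : Type*} [MeasurableSpace Ω]
    {P : Measure Ω} {N : Ω → ℕ∞} (hN : ∀ k : ℕ, NullMeasurableSet {ω | (k : ℕ∞) ≤ N ω} P) :
    AEMeasurable (fun ω => (N ω : ℝ≥0∞)) P := by
  have hfiber : ∀ k : ℕ, NullMeasurableSet (N ⁻¹' {(k : ℕ∞)}) P := fun k => by
    convert (hN k).diff (hN (k + 1)) using 1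
    ext ω
    rw [Set.mem_preimage, Set.mem_singleton_iff, Set.mem_sdiff, Set.mem_ofPred_eq,
      Set.mem_ofPred_eq, Nat.cast_add_one, ENat.add_one_le_iff (ENat.natCast_ne_top k), not_lt,
      eq_comm, le_antisymm_iff]
  have hnull : NullMeasurable N P :=
    (ENat.measurable_iff (α := NullMeasurableSpace Ω P) (f := N)).2 hfiber
  exact Measurable.of_discrete.comp_aemeasurable hnull.aemeasurable

theorem aemeasurable_zeroCount {Ω : Type*} [MeasurableSpace Ω] {P : Measure Ω} {F : Ω → ℝ → ℝ}
    (hF : ∀ ω, Continuous (F ω)) (hm : ∀ t, AEMeasurable (fun ω => F ω t) P) :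
    AEMeasurable (fun ω => (zeroCount (F ω) : ℝ≥0∞)) P := by
  have hinter : ∀ i : ℚ × ℚ, NullMeasurableSet
      {ω | ({t | t ∈ Set.Icc 0 (2 * Real.pi) ∧ F ω t = 0} ∩ Set.Icc (i.1 : ℝ) i.2).Nonempty} P :=
    fun i => by
      convert nullMeasurableSet_exists_mem_eq_zero
        ((isCompact_Icc (a := 0) (b := 2 * Real.pi)).inter_right isClosed_Icc)
        (fun ω => (hF ω).continuousOn) (fun t _ => hm t) using 3 with ω
      exact exists_congr fun t => and_right_comm
  refine aemeasurable_toENNReal_of_nullMeasurableSet_le fun k => ?_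
  simp only [zeroCount, natCast_le_encard_iff_exists_pairwiseDisjoint_Icc, Set.ofPred_exists,
    Set.ofPred_and, Set.ofPred_forall]
  exact NullMeasurableSet.iUnion fun s => (NullMeasurableSet.const _).inter <|
    (NullMeasurableSet.const _).inter <|
      NullMeasurableSet.biInter (Finset.countable_toSet s) fun i _ => hinter i

end Measurability

section ComplexCoeff

/-- The coefficients `a_k - i b_k` for which `∑_{k=1}^n (a_k cos (k t) + b_k sin (k t))` is the real
part of `trigSum`, for the realization `ω`. -/
noncomputable def complexCoeff {Ω : Type*} (a b : ℕ → Ω → ℝ) (ω : Ω) (k : ℕ) : ℂ :=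
  a k ω - b k ω * Complex.I

variable {Ω : Type*} (a b : ℕ → Ω → ℝ) (ω : Ω) (k : ℕ)

theorem re_complexCoeff : (complexCoeff a b ω k).re = a k ω := by
  simp [complexCoeff]

theorem im_complexCoeff : (complexCoeff a b ω k).im = -b k ω := by
  simp [complexCoeff]

end ComplexCoeff

section Gaussian

variable {Ω : Type*} [MeasurableSpace Ω] {P : Measure Ω}

theorem ae_ne_zero_of_hasGaussianLaw {Y : Ω → ℝ} (h : HasGaussianLaw Y P)
    (hv : Var[Y; P] ≠ 0) : ∀ᵐ ω ∂P, Y ω ≠ 0 := by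
  have hpos : Var[Y; P].toNNReal ≠ 0 :=
    (Real.toNNReal_pos.2 ((variance_nonneg Y P).lt_of_ne' hv)).ne'
  have := nullSingletonClass_gaussianReal (μ := P[Y]) hpos
  have hmap : P.map Y {0} = 0 := by
    rw [h.map_eq_gaussianReal]
    exact measure_singleton 0
  rw [Measure.map_apply_of_aemeasurable h.aemeasurable (measurableSet_singleton 0)] at hmap
  exact measure_eq_zero_iff_ae_notMem.1 hmap

theorem IsStationaryGaussian.aemeasurable {ρ : ℕ → ℝ} {X : ℕ → Ω → ℝ}
    (h : IsStationaryGaussian ρ X P) {k : ℕ} (hk : 1 ≤ k) : AEMeasurable (X k) P :=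
  h.gaussian.aemeasurable ⟨k, hk⟩

theorem IsStationaryGaussian.memLp_two {ρ : ℕ → ℝ} {X : ℕ → Ω → ℝ}
    (h : IsStationaryGaussian ρ X P) (k : ℕ+) : MemLp (X k) 2 P :=
  (h.gaussian.hasGaussianLaw_eval k).memLp_two

section Linear

variable {α : ℝ} {X : ℕ → Ω → ℝ} {ι : Type*} [Fintype ι]

theorem IsStationaryGaussian.hasGaussianLaw_sum {ρ : ℕ → ℝ} (h : IsStationaryGaussian ρ X P)
    (k : ι → ℕ+) (x : ι → ℝ) : HasGaussianLaw (fun ω => ∑ i, x i * X (k i) ω) P :=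
  ((h.gaussian.comp_right k).smul x).hasGaussianLaw_fun_sum

theorem IsStationaryGaussian.integral_mul
    (h : IsStationaryGaussian (fun k : ℕ => Real.cos (k * α)) X P) (k l : ℕ+) :
    ∫ ω, X k ω * X l ω ∂P =
      Real.cos (k * α) * Real.cos (l * α) + Real.sin (k * α) * Real.sin (l * α) := by
  wlog hkl : k ≤ l generalizing k l
  · simpa only [mul_comm] using this l k (le_of_not_ge hkl)
  obtain ⟨j, hj⟩ := Nat.exists_eq_add_of_le (PNat.coe_le_coe k l |>.2 hkl)
  have hl : (l * α : ℝ) = k * α + j * α := by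
    rw [hj]
    push_cast
    ring
  rw [hj, h.correlation k j k.pos, ← hj, mul_comm (Real.cos _), mul_comm (Real.sin _),
    ← Real.cos_sub, hl, add_sub_cancel_left]

theorem IsStationaryGaussian.integral_sum_sq
    (h : IsStationaryGaussian (fun k : ℕ => Real.cos (k * α)) X P) (k : ι → ℕ+) (x : ι → ℝ) :
    ∫ ω, (∑ i, x i * X (k i) ω) ^ 2 ∂P =
      (∑ i, x i * Real.cos (k i * α)) ^ 2 + (∑ i, x i * Real.sin (k i * α)) ^ 2 := by
  have hint : ∀ i j, Integrable (fun ω => x i * X (k i) ω * (x j * X (k j) ω)) P := fun i j =>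
    ((h.memLp_two (k i)).const_mul (x i)).integrable_mul ((h.memLp_two (k j)).const_mul (x j))
  simp_rw [sq, Finset.sum_mul_sum]
  rw [integral_finsetSum _ fun i _ => integrable_finsetSum _ fun j _ => hint i j,
    ← Finset.sum_add_distrib]
  refine Finset.sum_congr rfl fun i _ => ?_
  rw [integral_finsetSum _ fun j _ => hint i j, ← Finset.sum_add_distrib]
  refine Finset.sum_congr rfl fun j _ => ?_
  simp_rw [mul_mul_mul_comm (x i)]
  rw [integral_const_mul, h.integral_mul, mul_add]

theorem IsStationaryGaussian.variance_sum [IsProbabilityMeasure P]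
    (h : IsStationaryGaussian (fun k : ℕ => Real.cos (k * α)) X P) (k : ι → ℕ+) (x : ι → ℝ) :
    Var[fun ω => ∑ i, x i * X (k i) ω; P] =
      (∑ i, x i * Real.cos (k i * α)) ^ 2 + (∑ i, x i * Real.sin (k i * α)) ^ 2 := by
  have hmean : ∫ ω, ∑ i, x i * X (k i) ω ∂P = 0 := by
    rw [integral_finsetSum _ fun i _ =>
      ((h.memLp_two (k i)).integrable one_le_two).const_mul (x i)]
    exact Finset.sum_eq_zero fun i _ => by
      rw [integral_const_mul, h.mean_zero _ (k i).pos, mul_zero]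
  rw [variance_of_integral_eq_zero (h.hasGaussianLaw_sum k x).aemeasurable hmean,
    h.integral_sum_sq]

theorem IsStationaryGaussian.ae_sum_eq_zero
    (h : IsStationaryGaussian (fun k : ℕ => Real.cos (k * α)) X P) {k : ι → ℕ+} {x : ι → ℝ}
    (hcos : ∑ i, x i * Real.cos (k i * α) = 0) (hsin : ∑ i, x i * Real.sin (k i * α) = 0) :
    ∀ᵐ ω ∂P, ∑ i, x i * X (k i) ω = 0 := by
  have hint := h.integral_sum_sq k x
  rw [hcos, hsin, sq, zero_mul, zero_add,
    integral_eq_zero_iff_of_nonneg (fun ω => sq_nonneg _)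
      (h.hasGaussianLaw_sum k x).memLp_two.integrable_sq] at hint
  exact hint.mono fun ω hω => pow_eq_zero_iff two_ne_zero |>.1 hω

theorem IsStationaryGaussian.ae_exists_eq_cos_add_sin
    (h : IsStationaryGaussian (fun k : ℕ => Real.cos (k * α)) X P) :
    ∀ᵐ ω ∂P, ∃ y : ℝ, ∀ k : ℕ, 1 ≤ k → X k ω =
      (2 * Real.cos α * X 1 ω - X 2 ω) * Real.cos (k * α) + y * Real.sin (k * α) := by
  have hk : ∀ k : ℕ+, ∀ᵐ ω ∂P, X k ω =
      (2 * Real.cos α * X 1 ω - X 2 ω) * Real.cos (k * α) +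
        (Real.cos α * X 2 ω - Real.cos (2 * α) * X 1 ω) / Real.sin α * Real.sin (k * α) := by
    intro k
    -- If `sin α = 0`, the quotient by it is the junk value `0`, but then `sin (k α) = 0` too.
    obtain ⟨r, hr, hr'⟩ : ∃ r, r = Real.sin (k * α) / Real.sin α ∧
        r * Real.sin α = Real.sin (k * α) := by
      refine ⟨_, rfl, div_mul_cancel_of_imp fun h0 => ?_⟩
      obtain ⟨j, rfl⟩ := Real.sin_eq_zero_iff.1 h0
      rw [← mul_assoc]
      exact_mod_cast Real.sin_int_mul_pi (k * j)
    have hzero := h.ae_sum_eq_zero (k := ![k, 1, 2])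
      (x := ![1, Real.cos (2 * α) * r - 2 * Real.cos α * Real.cos (k * α),
        Real.cos (k * α) - Real.cos α * r])
    simp only [Fin.sum_univ_three, Matrix.cons_val, PNat.val_ofNat, Nat.cast_one, Nat.cast_ofNat,
      one_mul, Real.cos_two_mul, Real.sin_two_mul] at hzero
    filter_upwards [hzero (by ring) (by linear_combination (-1) * hr')] with ω hω
    rw [div_mul_eq_mul_div, mul_div_assoc, ← hr, Real.cos_two_mul]
    linear_combination hω
  filter_upwards [ae_all_iff.2 hk] with ω hω
  exact ⟨_, fun k hk => hω ⟨k, hk⟩⟩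

end Linear

section Pair

variable [IsProbabilityMeasure P] {α : ℝ} {a b : ℕ → Ω → ℝ}

theorem IsCosineGaussianPair.ae_sum_add_sum_ne_zero (h : IsCosineGaussianPair α a b P)
    {ι : Type*} [Fintype ι] {k : ι → ℕ+} {x u : ι → ℝ}
    (h0 : (∑ i, x i * Real.cos (k i * α)) ^ 2 + (∑ i, x i * Real.sin (k i * α)) ^ 2 +
      ((∑ i, u i * Real.cos (k i * α)) ^ 2 + (∑ i, u i * Real.sin (k i * α)) ^ 2) ≠ 0) :
    ∀ᵐ ω ∂P, ∑ i, x i * a (k i) ω + ∑ i, u i * b (k i) ω ≠ 0 := by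
  have hY := h.left.hasGaussianLaw_sum k x
  have hZ := h.right.hasGaussianLaw_sum k u
  have hmeas : ∀ y : ι → ℝ, Measurable fun f : ℕ+ → ℝ => ∑ i, y i * f (k i) := fun y => by
    fun_prop
  have hindep : IndepFun (fun ω => ∑ i, x i * a (k i) ω) (fun ω => ∑ i, u i * b (k i) ω) P :=
    h.indep.comp (hmeas x) (hmeas u)
  refine ae_ne_zero_of_hasGaussianLaw (hindep.hasGaussianLaw hY hZ).fun_add ?_
  rwa [hindep.variance_fun_add hY.memLp_two hZ.memLp_two, h.left.variance_sum,
    h.right.variance_sum]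

theorem IsCosineGaussianPair.ae_re_complexCoeff_mul_exp_ne_zero
    (h : IsCosineGaussianPair α a b P) (x : ℝ) :
    ∀ᵐ ω ∂P, (complexCoeff a b ω 1 * Complex.exp (x * Complex.I)).re ≠ 0 := by
  have hne := h.ae_sum_add_sum_ne_zero (ι := Unit) (k := fun _ => 1) (x := fun _ => Real.cos x)
    (u := fun _ => Real.sin x)
  simp only [Finset.univ_unique, Finset.sum_singleton, PNat.one_coe, Nat.cast_one, one_mul] at hne
  refine (hne ?_).mono fun ω hω h0 => hω ?_
  · have hα := Real.sin_sq_add_cos_sq α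
    have hx := Real.sin_sq_add_cos_sq x
    refine ne_of_eq_of_ne ?_ one_ne_zero
    linear_combination (Real.sin x ^ 2 + Real.cos x ^ 2) * hα + hx
  · rw [Complex.mul_re, Complex.exp_ofReal_mul_I_re, Complex.exp_ofReal_mul_I_im,
      re_complexCoeff, im_complexCoeff] at h0
    linear_combination h0

theorem IsCosineGaussianPair.ae_im_complexCoeff_sub_mul_exp_ne_zero
    (h : IsCosineGaussianPair α a b P) {x : ℝ} (hx : Real.cos x ≠ Real.cos α) :
    ∀ᵐ ω ∂P, (complexCoeff a b ω 1 - (2 * Real.cos α * complexCoeff a b ω 1 -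
      complexCoeff a b ω 2) * Complex.exp (x * Complex.I)).im ≠ 0 := by
  have hne := h.ae_sum_add_sum_ne_zero (k := ![1, 2])
    (x := ![-(2 * Real.cos α * Real.sin x), Real.sin x])
    (u := ![-1 + 2 * Real.cos α * Real.cos x, -Real.cos x])
  simp only [Fin.sum_univ_two, Matrix.cons_val, PNat.val_ofNat, Nat.cast_one, Nat.cast_ofNat,
      one_mul, Real.cos_two_mul, Real.sin_two_mul] at hne
  refine (hne ?_).mono fun ω hω h0 => hω ?_
  · have hpos : 0 < Real.sin x ^ 2 + (Real.cos x - Real.cos α) ^ 2 + Real.sin α ^ 2 := by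
      have := sub_ne_zero.2 hx
      positivity
    convert hpos.ne' using 1
    ring
  · rw [← Complex.ofReal_ofNat, ← Complex.ofReal_mul, Complex.sub_im, Complex.mul_im,
      Complex.exp_ofReal_mul_I_re, Complex.exp_ofReal_mul_I_im, Complex.sub_re, Complex.sub_im,
      Complex.re_ofReal_mul, Complex.im_ofReal_mul] at h0
    simp only [re_complexCoeff, im_complexCoeff] at h0
    linear_combination h0

theorem IsCosineGaussianPair.ae_exists_eqOn_cosineSeq (h : IsCosineGaussianPair α a b P) :
    ∀ᵐ ω ∂P, ∃ A B, Set.EqOn (complexCoeff a b ω) (cosineSeq α A B) (Set.Ici 1) ∧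
      IsGenericCosineSeq α (cosineSeq α A B) := by
  have hre := ae_all_iff.2 fun r : ℚ => h.ae_re_complexCoeff_mul_exp_ne_zero (r * Real.pi)
  have him : ∀ᵐ ω ∂P, ∀ r : ℚ, Real.cos (r * Real.pi) ≠ Real.cos α → (complexCoeff a b ω 1 -
      (2 * Real.cos α * complexCoeff a b ω 1 - complexCoeff a b ω 2) *
        Complex.exp ((r * Real.pi : ℝ) * Complex.I)).im ≠ 0 := by
    simp_rw [ae_all_iff]
    exact fun r hr => h.ae_im_complexCoeff_sub_mul_exp_ne_zero hr
  filter_upwards [h.left.ae_exists_eq_cos_add_sin, h.right.ae_exists_eq_cos_add_sin, hre, him]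
    with ω ⟨y, hy⟩ ⟨v, hv⟩ hreω himω
  set c := complexCoeff a b ω with hc
  set A := 2 * Real.cos α * c 1 - c 2 with hA
  set B : ℂ := y - v * Complex.I
  have heq : Set.EqOn c (cosineSeq α A B) (Set.Ici 1) := fun k hk => by
    rw [hc, complexCoeff, hy k hk, hv k hk, cosineSeq, hA, hc, complexCoeff, complexCoeff]
    push_cast
    ring
  have hzero : cosineSeq α A B 0 = A := by simp [cosineSeq]
  refine ⟨A, B, heq, ⟨fun r => ?_, fun r hr => ?_⟩⟩
  · rw [← heq Set.self_mem_Ici]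
    exact hreω r
  · rw [hzero, ← heq Set.self_mem_Ici]
    exact himω r hr

end Pair

end Gaussian

section Realizations

variable {Ω : Type*} {a b : ℕ → Ω → ℝ}

theorem re_exp_mul_trigSum_complexCoeff (ω : Ω) (s t : ℝ) (n : ℕ) :
    (Complex.exp (s * Complex.I) * trigSum (complexCoeff a b ω) n t).re =
      ∑ k ∈ Finset.Icc 1 n, (a k ω * Real.cos (k * t + s) + b k ω * Real.sin (k * t + s)) := by
  rw [trigSum, Finset.mul_sum, Complex.re_sum]
  refine Finset.sum_congr rfl fun k _ => ?_
  rw [mul_left_comm, exp_ofReal_mul_I_pow, ← Complex.exp_add, ← add_mul, ← Complex.ofReal_add,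
    Complex.mul_re, Complex.exp_ofReal_mul_I_re, Complex.exp_ofReal_mul_I_im, re_complexCoeff,
    im_complexCoeff, add_comm s, neg_mul, sub_neg_eq_add]

theorem randTrigPoly_eq_re_trigSum (n : ℕ) (ω : Ω) (t : ℝ) : randTrigPoly a b n ω t =
    1 / Real.sqrt n * (trigSum (complexCoeff a b ω) n t).re := by
  have h := re_exp_mul_trigSum_complexCoeff (a := a) (b := b) ω 0 t n
  simp only [Complex.ofReal_zero, zero_mul, Complex.exp_zero, one_mul, add_zero] at h
  rw [randTrigPoly, h]

theorem randTrigFactor_eq_re_exp_mul_trigSum (q n : ℕ) (ω : Ω) : randTrigFactor a b q n ω =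
    fun t => (Complex.exp (((n - q) * t / 2 : ℝ) * Complex.I) *
      trigSum (complexCoeff a b ω) q t).re := by
  ext t
  rw [re_exp_mul_trigSum_complexCoeff, randTrigFactor]

theorem zeroCount_randTrigPoly {n : ℕ} (hn : 0 < n) (ω : Ω) : zeroCount (randTrigPoly a b n ω) =
    zeroCount fun t => (trigSum (complexCoeff a b ω) n t).re := by
  have h : 1 / Real.sqrt n ≠ 0 := by positivity
  simp only [zeroCount, randTrigPoly_eq_re_trigSum, mul_eq_zero, h, false_or]

theorem continuous_randTrigPoly (n : ℕ) (ω : Ω) : Continuous (randTrigPoly a b n ω) := by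
  unfold randTrigPoly
  fun_prop

theorem continuous_randTrigFactor (q n : ℕ) (ω : Ω) : Continuous (randTrigFactor a b q n ω) := by
  unfold randTrigFactor
  fun_prop

theorem randTrigPoly_eq_randTrigFactor_mul {α : ℝ} {A B : ℂ} {ω : Ω} {q n : ℕ}
    (hc : Set.EqOn (complexCoeff a b ω) (cosineSeq α A B) (Set.Ici 1))
    (hper : Function.Periodic (cosineSeq α A B) q) (hqn : q ∣ n) {t : ℝ}
    (ht : Real.sin (q * t / 2) ≠ 0) :
    randTrigPoly a b n ω t = 1 / Real.sqrt n * randTrigFactor a b q n ω t *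
      (Real.sin (n * t / 2) / Real.sin (q * t / 2)) := by
  have hre := congrArg Complex.re (sin_mul_trigSum_of_dvd hper hqn t)
  rw [Complex.re_ofReal_mul, Complex.re_ofReal_mul] at hre
  rw [randTrigPoly_eq_re_trigSum, randTrigFactor_eq_re_exp_mul_trigSum, trigSum_congr hc,
    trigSum_congr hc, mul_assoc]
  congr 1
  field_simp
  linear_combination hre

end Realizations

section Expectation

variable {Ω : Type*} [MeasurableSpace Ω] {P : Measure Ω} {α : ℝ} {a b : ℕ → Ω → ℝ}

theorem IsCosineGaussianPair.aemeasurable_zeroCount_randTrigPoly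
    (h : IsCosineGaussianPair α a b P) (n : ℕ) :
    AEMeasurable (fun ω => (zeroCount (randTrigPoly a b n ω) : ℝ≥0∞)) P := by
  refine aemeasurable_zeroCount (continuous_randTrigPoly n) fun t => ?_
  refine (Finset.aemeasurable_fun_sum _ fun k hk => ?_).const_mul _
  have hk1 := (Finset.mem_Icc.1 hk).1
  exact ((h.left.aemeasurable hk1).mul_const _).add ((h.right.aemeasurable hk1).mul_const _)

theorem IsCosineGaussianPair.aemeasurable_zeroCount_randTrigFactor
    (h : IsCosineGaussianPair α a b P) (q n : ℕ) :
    AEMeasurable (fun ω => (zeroCount (randTrigFactor a b q n ω) : ℝ≥0∞)) P := by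
  refine aemeasurable_zeroCount (continuous_randTrigFactor q n) fun t => ?_
  refine Finset.aemeasurable_fun_sum _ fun k hk => ?_
  have hk1 := (Finset.mem_Icc.1 hk).1
  exact ((h.left.aemeasurable hk1).mul_const _).add ((h.right.aemeasurable hk1).mul_const _)

variable [IsProbabilityMeasure P]

theorem IsCosineGaussianPair.ae_zeroCount_randTrigPoly_eq
    (h : IsCosineGaussianPair 0 a b P) :
    ∀ᵐ ω ∂P, ∀ n : ℕ, 1 ≤ n → zeroCount (randTrigPoly a b n ω) = ((2 * n : ℕ) : ℕ∞) := by
  filter_upwards [h.ae_exists_eqOn_cosineSeq] with ω ⟨A, B, hc, hgen⟩ n hn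
  rw [zeroCount_randTrigPoly hn, trigSum_congr hc, cosineSeq_zero]
  exact zeroCount_re_trigSum_const hn (by simpa only [cosineSeq_zero] using hgen.re_ne_zero)

theorem expectedZeros_le_of_ae_le {F : Ω → ℝ → ℝ} {m : ℕ} (h : ∀ᵐ ω ∂P, zeroCount (F ω) ≤ m) :
    expectedZeros P F ≤ m := by
  calc expectedZeros P F ≤ ∫⁻ _, (m : ℝ≥0∞) ∂P :=
        lintegral_mono_ae (h.mono fun ω hω => by exact_mod_cast ENat.toENNReal_le.2 hω)
    _ = m := by rw [lintegral_const, measure_univ, mul_one]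

theorem le_expectedZeros_add_of_ae_le {F : Ω → ℝ → ℝ} {m l : ℕ}
    (h : ∀ᵐ ω ∂P, (m : ℕ∞) ≤ zeroCount (F ω) + l) : (m : ℝ≥0∞) ≤ expectedZeros P F + l := by
  calc (m : ℝ≥0∞) = ∫⁻ _, (m : ℝ≥0∞) ∂P := by rw [lintegral_const, measure_univ, mul_one]
    _ ≤ ∫⁻ ω, ((zeroCount (F ω) : ℝ≥0∞) + l) ∂P :=
        lintegral_mono_ae (h.mono fun ω hω => by exact_mod_cast ENat.toENNReal_le.2 hω)
    _ = expectedZeros P F + l := by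
        rw [lintegral_add_right _ measurable_const, expectedZeros, lintegral_const, measure_univ,
          mul_one]

theorem IsCosineGaussianPair.expectedZeros_randTrigPoly_le (h : IsCosineGaussianPair α a b P)
    {n : ℕ} (hn : 0 < n) : expectedZeros P (randTrigPoly a b n) ≤ (2 * n + 1 : ℕ) := by
  refine expectedZeros_le_of_ae_le ?_
  filter_upwards [h.ae_exists_eqOn_cosineSeq] with ω ⟨A, B, hc, hgen⟩
  rw [zeroCount_randTrigPoly hn, trigSum_congr hc]
  exact zeroCount_re_trigSum_le ⟨1, Finset.mem_Icc.2 ⟨le_rfl, hn⟩, hgen.one_ne_zero⟩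

theorem IsCosineGaussianPair.le_expectedZeros_randTrigPoly (h : IsCosineGaussianPair α a b P)
    {n : ℕ} (hn : 0 < n) (hα : Real.sin (n * α) = 0) :
    ((2 * n : ℕ) : ℝ≥0∞) ≤ expectedZeros P (randTrigPoly a b n) + (5 : ℕ) := by
  refine le_expectedZeros_add_of_ae_le ?_
  filter_upwards [h.ae_exists_eqOn_cosineSeq] with ω ⟨A, B, hc, hgen⟩
  rw [zeroCount_randTrigPoly hn, trigSum_congr hc]
  exact hgen.le_zeroCount_re_trigSum_add hn hα

theorem IsCosineGaussianPair.le_expectedZeros_randTrigFactor (h : IsCosineGaussianPair α a b P)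
    {q : ℕ} (hα : Real.sin (q * α) = 0) (n : ℕ) :
    (n : ℝ≥0∞) ≤ expectedZeros P (randTrigFactor a b q n) + (3 : ℕ) := by
  refine le_expectedZeros_add_of_ae_le ?_
  filter_upwards [h.ae_exists_eqOn_cosineSeq] with ω ⟨A, B, hc, _⟩
  rw [randTrigFactor_eq_re_exp_mul_trigSum, trigSum_congr hc]
  exact le_zeroCount_re_exp_mul_trigSum_add hα

theorem IsCosineGaussianPair.abs_expectedZeros_div_sub_two_le (h : IsCosineGaussianPair α a b P)
    {n : ℕ} (hn : 0 < n) (hα : Real.sin (n * α) = 0) :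
    |(expectedZeros P (randTrigPoly a b n)).toReal / n - 2| ≤ 5 / n := by
  have hle := h.expectedZeros_randTrigPoly_le hn
  have hge := h.le_expectedZeros_randTrigPoly hn hα
  have hfin := ne_top_of_le_ne_top (ENNReal.natCast_ne_top _) hle
  lift expectedZeros P (randTrigPoly a b n) to NNReal using hfin with E
  have hle' : (E : ℝ) ≤ 2 * n + 1 := by exact_mod_cast hle
  have hge' : (2 * n : ℝ) ≤ E + 5 := by exact_mod_cast hge
  have hn0 : (0 : ℝ) < n := by positivity
  rw [ENNReal.coe_toReal, div_sub' hn0.ne', abs_div, abs_of_pos hn0]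
  gcongr
  exact abs_le.2 ⟨by linarith, by linarith⟩

theorem IsCosineGaussianPair.tendsto_expectedZeros_div (h : IsCosineGaussianPair α a b P) :
    Tendsto
      (fun n : ℕ => |(expectedZeros P (randTrigPoly a b n)).toReal / n - 2| *
        Set.indicator {m : ℕ | ∃ j : ℤ, (m : ℝ) * α = j * Real.pi} (fun _ => (1 : ℝ)) n)
      atTop (𝓝 0) := by
  refine squeeze_zero' (g := fun n : ℕ => 5 / (n : ℝ)) (Eventually.of_forall fun n =>
    mul_nonneg (abs_nonneg _) (Set.indicator_nonneg (fun _ _ => zero_le_one) _)) ?_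
    (tendsto_const_div_atTop_nhds_zero_nat 5)
  filter_upwards [eventually_gt_atTop 0] with n hn
  by_cases hmem : n ∈ {m : ℕ | ∃ j : ℤ, (m : ℝ) * α = j * Real.pi}
  · rw [Set.indicator_of_mem hmem, mul_one]
    obtain ⟨j, hj⟩ := hmem
    exact h.abs_expectedZeros_div_sub_two_le hn (by rw [hj, Real.sin_int_mul_pi])
  · rw [Set.indicator_of_notMem hmem, mul_zero]
    positivity

theorem one_le_liminf_div_of_natCast_le_add {u : ℕ → ℝ≥0∞} {l : ℕ} (h : ∀ n : ℕ, n ≤ u n + l) :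
    1 ≤ liminf (fun n : ℕ => u n / n) atTop := by
  have hlim : Tendsto (fun n : ℕ => (1 : ℝ≥0∞) - l / n) atTop (𝓝 1) := by
    have hdiv : Tendsto (fun n : ℕ => (l : ℝ≥0∞) / n) atTop (𝓝 0) := by
      simpa using ENNReal.Tendsto.const_div ENNReal.tendsto_nat_nhds_top
        (Or.inr (ENNReal.natCast_ne_top l))
    simpa using ENNReal.Tendsto.sub tendsto_const_nhds hdiv (Or.inl ENNReal.one_ne_top)
  rw [← hlim.liminf_eq]
  refine liminf_le_liminf ?_
  filter_upwards [eventually_ne_atTop 0] with n hn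
  rw [tsub_le_iff_right, ← ENNReal.add_div, ENNReal.le_div_iff_mul_le
    (Or.inl (Nat.cast_ne_zero.2 hn)) (Or.inl (ENNReal.natCast_ne_top n)), one_mul]
  exact h n

theorem IsCosineGaussianPair.ae_randTrigPoly_eq_randTrigFactor_mul
    (h : IsCosineGaussianPair α a b P) {q : ℕ} (hα : Real.cos (q * α) = 1) :
    ∀ᵐ ω ∂P, ∀ n : ℕ, q ∣ n → ∀ t : ℝ, Real.sin (q * t / 2) ≠ 0 →
      randTrigPoly a b n ω t = 1 / Real.sqrt n * randTrigFactor a b q n ω t *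
        (Real.sin (n * t / 2) / Real.sin (q * t / 2)) := by
  filter_upwards [h.ae_exists_eqOn_cosineSeq] with ω ⟨A, B, hc, _⟩ n hqn t ht
  refine randTrigPoly_eq_randTrigFactor_mul hc (fun k => ?_) hqn ht
  rw [cosineSeq_add_of_sin_eq_zero (Real.sin_eq_zero_iff_cos_eq.2 (Or.inl hα)), hα,
    Complex.ofReal_one, one_mul]

end Expectation

theorem cos_natCast_mul_eq_one {α : ℝ} {p q : ℕ} (hq : 0 < q) (hα : α = 2 * Real.pi * p / q) :
    Real.cos (q * α) = 1 := by
  rw [hα, mul_div_cancel₀ _ (by positivity), mul_comm, Real.cos_nat_mul_two_pi]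

theorem proposition1_general {Ω : Type*} [MeasurableSpace Ω] (P : Measure Ω)
    [IsProbabilityMeasure P] (α : ℝ) (a b : ℕ → Ω → ℝ) (hab : IsCosineGaussianPair α a b P) :
    (α = 0 → ∀ᵐ ω ∂P, ∀ n : ℕ, 1 ≤ n → zeroCount (randTrigPoly a b n ω) = ((2 * n : ℕ) : ℕ∞)) ∧
    ((∀ n : ℕ, 1 ≤ n →
        AEMeasurable (fun ω => (zeroCount (randTrigPoly a b n ω) : ℝ≥0∞)) P ∧
        expectedZeros P (randTrigPoly a b n) ≠ ∞) ∧
      Tendsto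
        (fun n : ℕ => |(expectedZeros P (randTrigPoly a b n)).toReal / n - 2| *
          Set.indicator {m : ℕ | ∃ j : ℤ, (m : ℝ) * α = j * Real.pi} (fun _ => (1 : ℝ)) n)
        atTop (𝓝 0)) ∧
    (∀ q : ℕ, Real.cos (q * α) = 1 →
      (∀ᵐ ω ∂P, ∀ n : ℕ, 1 ≤ n → q ∣ n → ∀ t : ℝ, Real.sin (q * t / 2) ≠ 0 →
        randTrigPoly a b n ω t =
          1 / Real.sqrt n * randTrigFactor a b q n ω t *
            (Real.sin (n * t / 2) / Real.sin (q * t / 2))) ∧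
      (∀ n : ℕ, AEMeasurable (fun ω => (zeroCount (randTrigFactor a b q n ω) : ℝ≥0∞)) P) ∧
      1 ≤ liminf (fun n : ℕ => expectedZeros P (randTrigFactor a b q n) / (n : ℝ≥0∞))
        (atTop ⊓ 𝓟 {n : ℕ | q ∣ n})) := by
  refine ⟨?_, ⟨fun n hn => ⟨hab.aemeasurable_zeroCount_randTrigPoly n,
      ne_top_of_le_ne_top (ENNReal.natCast_ne_top _) (hab.expectedZeros_randTrigPoly_le hn)⟩,
    hab.tendsto_expectedZeros_div⟩, fun q hq =>
    ⟨(hab.ae_randTrigPoly_eq_randTrigFactor_mul hq).mono fun _ h n _ => h n,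
      hab.aemeasurable_zeroCount_randTrigFactor q, ?_⟩⟩
  · rintro rfl
    exact hab.ae_zeroCount_randTrigPoly_eq
  · have hsin : Real.sin (q * α) = 0 := Real.sin_eq_zero_iff_cos_eq.2 (Or.inl hq)
    exact (one_le_liminf_div_of_natCast_le_add (hab.le_expectedZeros_randTrigFactor hsin)).trans
      (liminf_le_liminf_of_le inf_le_left)

theorem proposition1 {Ω : Type*} [MeasurableSpace Ω] (P : Measure Ω) [IsProbabilityMeasure P]
    (α : ℝ) (hα : 0 ≤ α) (a b : ℕ → Ω → ℝ) (hab : IsCosineGaussianPair α a b P) :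
    -- the case `α = 0`
    (α = 0 → ∀ᵐ ω ∂P, ∀ n : ℕ, 1 ≤ n → zeroCount (randTrigPoly a b n ω) = ((2 * n : ℕ) : ℕ∞)) ∧
    -- the case `α ∈ π ℚ`; the number of zeros is a random variable with finite expectation
    ((∃ r : ℚ, α = r * Real.pi) →
      (∀ n : ℕ, 1 ≤ n →
        AEMeasurable (fun ω => (zeroCount (randTrigPoly a b n ω) : ℝ≥0∞)) P ∧
        expectedZeros P (randTrigPoly a b n) ≠ ∞) ∧
      Tendsto
        (fun n : ℕ => |(expectedZeros P (randTrigPoly a b n)).toReal / n - 2| *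
          Set.indicator {m : ℕ | ∃ j : ℤ, (m : ℝ) * α = j * Real.pi} (fun _ => (1 : ℝ)) n)
        atTop (𝓝 0)) ∧
    -- the case `α = 2 π p / q`, `q ∣ n`: factorization and zeros of the random factor
    (∀ p q : ℕ, 0 < p → 0 < q → p.Coprime q → α = 2 * Real.pi * p / q →
      (∀ᵐ ω ∂P, ∀ n : ℕ, 1 ≤ n → q ∣ n → ∀ t : ℝ, Real.sin (q * t / 2) ≠ 0 →
        randTrigPoly a b n ω t =
          1 / Real.sqrt n * randTrigFactor a b q n ω t *
            (Real.sin (n * t / 2) / Real.sin (q * t / 2))) ∧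
      (∀ n : ℕ, 1 ≤ n → q ∣ n →
        AEMeasurable (fun ω => (zeroCount (randTrigFactor a b q n ω) : ℝ≥0∞)) P) ∧
      1 ≤ liminf (fun n : ℕ => expectedZeros P (randTrigFactor a b q n) / (n : ℝ≥0∞))
        (atTop ⊓ 𝓟 {n : ℕ | q ∣ n})) := by
  obtain ⟨hzero, hrat, hfactor⟩ := proposition1_general P α a b hab
  exact ⟨hzero, fun _ => hrat, fun p q _ hq _ hαpq =>
    (hfactor q (cos_natCast_mul_eq_one hq hαpq)).imp_right (.imp_left fun hmeas n _ _ => hmeas n)⟩
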